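/- There exist universal constants $\epsilon_0, c, C_{est} > 0$ such that the following holds for every $0 < \epsilon \le \epsilon_0$. Let $d, n$ be natural numbers, let $0 < \mu$ and $L$ be reals, let $\Sigma \in \mathbb{R}^{d\times d}$ be a matrix with $\mu I_d \preceq \Sigma \preceq L I_d$ in the Löwner order, and let $X_1, \dots, X_n$ be independent samples from the Gaussian distribution $\mathcal N(0,\Sigma)$ on $\mathbb{R}^d$. Write $\log^+ x = \max(\log x, 0)$ and $\|u\|_\Sigma^2 = u^T \Sigma u$. If $$ n \;\ge\; c\left( \frac{d \log d}{\epsilon^4} + \frac{d \log^+ \frac{L d}{\epsilon^7}}{\epsilon^2} \right), $$ then with probability at least $0.9$ the following is true: for every $u \in \mathbb{R}^d$ there exists $S_u \subseteq [n]$ with $|S_u| \ge (1-\epsilon^2) n$ and $$ \left\| \frac{1}{|S_u|} \sum_{i \in S_u} \langle X_i, u\rangle^2 X_i X_i^T \right\|_{op} \le C_{est}\, L\, \|u\|_\Sigma^2 , $$ where $\|\cdot\|_{op}$ is the spectral norm. (In the degenerate cases $d = 0$ or $n = 0$, $0\log 0 = 0$ and the empty average is $0$.) -/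

import Mathlib

open MeasureTheory ProbabilityTheory
open scoped MatrixOrder Matrix.Norms.L2Operator

/-- The squared Mahalanobis norm `‖u‖_Σ² = uᵀ Σ u`. -/
def mahalanobisSq {d : ℕ} (S : Matrix (Fin d) (Fin d) ℝ) (u : EuclideanSpace ℝ (Fin d)) : ℝ :=
  u.ofLp ⬝ᵥ S.mulVec u.ofLp

/-- The matrix `(1 / |T|) ∑_{i ∈ T} ⟨x_i, u⟩² x_i x_iᵀ` of a finite family of points `x`. -/
noncomputable def weightedCov {d n : ℕ} (x : Fin n → EuclideanSpace ℝ (Fin d))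
    (u : EuclideanSpace ℝ (Fin d)) (T : Finset (Fin n)) : Matrix (Fin d) (Fin d) ℝ :=
  (1 / (T.card : ℝ)) •
    ∑ i ∈ T, (inner ℝ (x i) u) ^ 2 • Matrix.vecMulVec (x i).ofLp (x i).ofLp

/-! Whitening by `CFC.sqrt S` reduces the claim to standard Gaussian points `z i`: every `v` needs a
large index set `T` on which `∑ ⟨z i, v⟩² ⟨z i, w⟩²` is `O(n)` for all unit `w`. This product has no
exponential moment, so `T` keeps the indices with `⟨z i, v⟩² ≤ r`, where `r = 3000 / ε²`. Since `∑
⟨z i, v⟩²` is `O(n)`, Markov's inequality over the indices shows that `T` loses at most `ε² n` of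
them.

The truncated product `min (⟨z, v⟩²) r * ⟨z, w⟩²` has a log-moment linear in `l` at `l = 1 / (16 r)`
(`integral_exp_truncated_stdGaussian_le`), so each pair `v, w` fails with probability at most `exp
(-16 n / r)`. This beats the `exp (8 d log d)` pairs from a net of mesh `1 / d` as soon as `n ≥ 3000
d log d / ε²`.

Passing from the net to the ball costs a multiple of `d⁻² ∑ ‖z i‖⁴`, which Markov's inequality
bounds by `O(n)`. The deterministic part is `exists_finset_sum_inner_sq_mul_le`. -/

/-! ### Exponential and fourth moments of the standard Gaussian. -/

section Gaussian

/-- The exponential square moment `E exp (X² / 4)` of a centred Gaussian of variance at most one. -/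
lemma integral_exp_sq_gaussianReal_le {v : NNReal} (hv : v ≤ 1) :
    Integrable (fun x : ℝ => Real.exp (x ^ 2 / 4)) (gaussianReal 0 v) ∧
      ∫ x, Real.exp (x ^ 2 / 4) ∂(gaussianReal 0 v) ≤ 2 := by
  have h1 : Integrable (fun x : ℝ => Real.exp (x ^ 2 / 4)) (gaussianReal 0 1) := by
    rw [gaussianReal_of_var_ne_zero 0 one_ne_zero,
      integrable_withDensity_iff_integrable_smul₀' (by fun_prop)
        (Filter.Eventually.of_forall fun x => by simp [gaussianPDF])]
    have h := (integrable_exp_neg_mul_sq (b := 1 / 4) (by norm_num)).const_mul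
      ((√(2 * Real.pi))⁻¹)
    refine h.congr (Filter.Eventually.of_forall fun x => ?_)
    beta_reduce
    rw [show gaussianPDF 0 1 x = ENNReal.ofReal (gaussianPDFReal 0 1 x) from rfl,
      ENNReal.toReal_ofReal (gaussianPDFReal_nonneg _ _ _), smul_eq_mul]
    simp only [gaussianPDFReal, NNReal.coe_one, mul_one, mul_assoc, ← Real.exp_add]
    ring_nf
  -- The exact value is `√(4π) / √(2π) = √2`.
  have h2 : ∫ x, Real.exp (x ^ 2 / 4) ∂(gaussianReal 0 1) ≤ 2 := by
    rw [integral_gaussianReal_eq_integral_smul one_ne_zero]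
    have : ∀ x : ℝ, gaussianPDFReal 0 1 x • Real.exp (x ^ 2 / 4) =
        (√(2 * Real.pi))⁻¹ * Real.exp (-(1 / 4) * x ^ 2) := fun x => by
      simp only [gaussianPDFReal, smul_eq_mul, NNReal.coe_one, mul_one, mul_assoc, ← Real.exp_add]
      ring_nf
    simp_rw [this]
    rw [integral_const_mul, integral_gaussian, inv_mul_le_iff₀ (by positivity),
      Real.sqrt_le_left (by positivity), mul_pow, Real.sq_sqrt (by positivity)]
    nlinarith [Real.pi_pos]
  have hmap : gaussianReal 0 v = (gaussianReal 0 1).map (fun x => √(v : ℝ) * x) := by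
    rw [show (fun x : ℝ => √(v : ℝ) * x) = (√(v : ℝ) * ·) from rfl, gaussianReal_map_const_mul]
    congr 1
    · simp
    · ext; simp
  have hle : ∀ x : ℝ, Real.exp ((√(v : ℝ) * x) ^ 2 / 4) ≤ Real.exp (x ^ 2 / 4) := fun x => by
    rw [Real.exp_le_exp, mul_pow, Real.sq_sqrt v.coe_nonneg]
    have : (v : ℝ) ≤ 1 := by exact_mod_cast hv
    nlinarith [sq_nonneg x]
  have h3 : Integrable (fun x : ℝ => Real.exp ((√(v : ℝ) * x) ^ 2 / 4)) (gaussianReal 0 1) := by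
    refine h1.mono (by fun_prop) (Filter.Eventually.of_forall fun x => ?_)
    simpa using hle x
  rw [hmap]
  constructor
  · rw [integrable_map_measure (by fun_prop) (by fun_prop)]
    exact h3
  · rw [integral_map (by fun_prop) (by fun_prop)]
    exact (integral_mono h3 h1 hle).trans h2

lemma integral_exp_sq_inner_stdGaussian_le {E : Type*} [NormedAddCommGroup E]
    [InnerProductSpace ℝ E] [FiniteDimensional ℝ E] [MeasurableSpace E] [BorelSpace E]
    {u : E} (hu : ‖u‖ ≤ 1) :
    Integrable (fun z : E => Real.exp (inner ℝ z u ^ 2 / 4)) (stdGaussian E) ∧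
      ∫ z, Real.exp (inner ℝ z u ^ 2 / 4) ∂(stdGaussian E) ≤ 2 := by
  have hmap : (stdGaussian E).map (innerSL ℝ u) = gaussianReal 0 (‖u‖ ^ 2).toNNReal := by
    rw [IsGaussian.map_eq_gaussianReal, integral_strongDual_stdGaussian, variance_dual_stdGaussian,
      innerSL_apply_norm]
  have hv : (‖u‖ ^ 2).toNNReal ≤ 1 := by
    rw [Real.toNNReal_le_one]
    exact pow_le_one₀ (norm_nonneg _) hu
  obtain ⟨h1, h2⟩ := integral_exp_sq_gaussianReal_le hv
  rw [← hmap] at h1 h2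
  rw [integrable_map_measure (by fun_prop) (by fun_prop)] at h1
  rw [integral_map (by fun_prop) (by fun_prop)] at h2
  simp only [Function.comp_def, innerSL_apply_apply, real_inner_comm _ u] at h1 h2
  exact ⟨h1, h2⟩

lemma pow_four_le_exp_sq (x : ℝ) : x ^ 4 ≤ 64 * Real.exp (x ^ 2 / 4) := by
  have h : x ^ 2 / 8 ≤ Real.exp (x ^ 2 / 8) := by linarith [Real.add_one_le_exp (x ^ 2 / 8)]
  have h2 : Real.exp (x ^ 2 / 4) = Real.exp (x ^ 2 / 8) ^ 2 := by
    rw [← Real.exp_nat_mul]; congr 1; push_cast; ring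
  rw [h2]
  nlinarith [pow_le_pow_left₀ (by positivity) h 2]

/-- Cauchy–Schwarz gives `‖z‖⁴ ≤ d ∑ z_j⁴`, and each `z_j⁴` is dominated by the exponential square,
of mean at most `2`. -/
lemma integral_norm_pow_four_stdGaussian_le (d : ℕ) :
    Integrable (fun z : EuclideanSpace ℝ (Fin d) => ‖z‖ ^ 4) (stdGaussian _) ∧
      ∫ z : EuclideanSpace ℝ (Fin d), ‖z‖ ^ 4 ∂(stdGaussian _) ≤ 128 * d ^ 2 := by
  let e : Fin d → EuclideanSpace ℝ (Fin d) := fun j => EuclideanSpace.single j 1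
  have he : ∀ j, ‖e j‖ ≤ 1 := fun j => by simp [e]
  have hle : ∀ z : EuclideanSpace ℝ (Fin d),
      ‖z‖ ^ 4 ≤ d * ∑ j, 64 * Real.exp (inner ℝ z (e j) ^ 2 / 4) := fun z => by
    have h1 : ‖z‖ ^ 4 = (∑ j, z j ^ 2) ^ 2 := by
      rw [← EuclideanSpace.real_norm_sq_eq]; ring
    have h2 := sq_sum_le_card_mul_sum_sq (s := Finset.univ) (f := fun j => z j ^ 2)
    simp only [Finset.card_univ, Fintype.card_fin, ← pow_mul] at h2
    rw [h1]
    refine h2.trans (mul_le_mul_of_nonneg_left (Finset.sum_le_sum fun j _ => ?_) (by positivity))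
    have : inner ℝ z (e j) = z j := by simp [e, EuclideanSpace.inner_single_right]
    rw [this]
    exact pow_four_le_exp_sq _
  have hint : Integrable (fun z : EuclideanSpace ℝ (Fin d) =>
      d * ∑ j, 64 * Real.exp (inner ℝ z (e j) ^ 2 / 4)) (stdGaussian _) :=
    (integrable_finsetSum _ fun j _ =>
      (integral_exp_sq_inner_stdGaussian_le (he j)).1.const_mul 64).const_mul _
  have hI : Integrable (fun z : EuclideanSpace ℝ (Fin d) => ‖z‖ ^ 4) (stdGaussian _) := by
    refine hint.mono' (by fun_prop) (Filter.Eventually.of_forall fun z => ?_)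
    simpa using hle z
  refine ⟨hI, (integral_mono hI hint hle).trans ?_⟩
  rw [integral_const_mul, integral_finsetSum _ fun j _ =>
      (integral_exp_sq_inner_stdGaussian_le (he j)).1.const_mul 64]
  have : ∑ j, ∫ z, 64 * Real.exp (inner ℝ z (e j) ^ 2 / 4) ∂(stdGaussian _) ≤
      ∑ _j : Fin d, (128 : ℝ) := Finset.sum_le_sum fun j _ => by
    rw [integral_const_mul]
    linarith [(integral_exp_sq_inner_stdGaussian_le (he j)).2]
  simp only [Finset.sum_const, Finset.card_univ, Fintype.card_fin, nsmul_eq_mul] at this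
  nlinarith [(Nat.cast_nonneg d : (0 : ℝ) ≤ d)]

/-- The exponential moment of the truncated product `min (⟨z, v⟩²) r * ⟨z, w⟩²`. -/
lemma integral_exp_truncated_stdGaussian_le {E : Type*} [NormedAddCommGroup E]
    [InnerProductSpace ℝ E] [FiniteDimensional ℝ E] [MeasurableSpace E] [BorelSpace E]
    {v w : E} (hv : ‖v‖ ≤ 1) (hw : ‖w‖ ≤ 1) {r : ℝ} (hr : 0 < r) :
    Integrable (fun z : E => Real.exp (1 / (16 * r) *
        (min (inner ℝ z v ^ 2) r * inner ℝ z w ^ 2))) (stdGaussian E) ∧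
      ∫ z, Real.exp (1 / (16 * r) * (min (inner ℝ z v ^ 2) r * inner ℝ z w ^ 2))
        ∂(stdGaussian E) ≤ Real.exp (256 * (1 / (16 * r))) := by
  obtain ⟨iv, bv⟩ := integral_exp_sq_inner_stdGaussian_le hv
  obtain ⟨iw, bw⟩ := integral_exp_sq_inner_stdGaussian_le hw
  -- In `exp x ≤ 1 + x exp x`, the factor `x` is bounded by `l a b`, dropping the truncation, while
  -- the exponent uses it: `x ≤ l r b = b / 16`. The polynomial factors are then absorbed into `exp
  -- (a / 4)` and `exp (b / 4)`, whose means are at most `2`; hence `64 * 4 = 256`.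
  have hle : ∀ z : E, Real.exp (1 / (16 * r) * (min (inner ℝ z v ^ 2) r * inner ℝ z w ^ 2)) ≤
      1 + 1 / (16 * r) * (64 * (Real.exp (inner ℝ z v ^ 2 / 4) +
        Real.exp (inner ℝ z w ^ 2 / 4))) := fun z => by
    set a := inner ℝ z v ^ 2 with ha
    set b := inner ℝ z w ^ 2 with hb
    have ha0 : 0 ≤ a := sq_nonneg _
    have hb0 : 0 ≤ b := sq_nonneg _
    set l := 1 / (16 * r) with hl
    have hl0 : 0 < l := by positivity
    have hlr : l * r = 1 / 16 := by rw [hl]; field_simp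
    set x := l * (min a r * b) with hx
    have hx0 : 0 ≤ x := by positivity
    have hxb : x ≤ b / 16 := by
      have : min a r * b ≤ r * b := mul_le_mul_of_nonneg_right (min_le_right _ _) hb0
      calc x ≤ l * (r * b) := mul_le_mul_of_nonneg_left this hl0.le
        _ = (l * r) * b := by ring
        _ = b / 16 := by rw [hlr]; ring
    have hxa : x ≤ l * (a * b) :=
      mul_le_mul_of_nonneg_left (mul_le_mul_of_nonneg_right (min_le_left _ _) hb0) hl0.le
    have hexp : Real.exp x ≤ 1 + x * Real.exp x := by
      have h1 := Real.add_one_le_exp (-x)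
      have h2 : Real.exp (-x) * Real.exp x = 1 := by rw [← Real.exp_add]; simp
      nlinarith [Real.exp_pos x]
    have h3 : x * Real.exp x ≤ l * (a * b) * Real.exp (b / 16) :=
      mul_le_mul hxa (Real.exp_le_exp.2 hxb) (Real.exp_pos _).le (by positivity)
    have h4 : a ≤ 8 * Real.exp (a / 8) := by linarith [Real.add_one_le_exp (a / 8)]
    have h5 : b ≤ 16 * Real.exp (b / 16) := by linarith [Real.add_one_le_exp (b / 16)]
    have h6 : a * b * Real.exp (b / 16) ≤ 128 * (Real.exp (a / 8) * Real.exp (b / 8)) := by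
      have : Real.exp (b / 8) = Real.exp (b / 16) * Real.exp (b / 16) := by
        rw [← Real.exp_add]; congr 1; ring
      calc a * b * Real.exp (b / 16)
          ≤ (8 * Real.exp (a / 8)) * (16 * Real.exp (b / 16)) * Real.exp (b / 16) := by gcongr
        _ = _ := by rw [this]; ring
    have h7 : Real.exp (a / 4) = Real.exp (a / 8) ^ 2 := by
      rw [← Real.exp_nat_mul]; congr 1; push_cast; ring
    have h8 : Real.exp (b / 4) = Real.exp (b / 8) ^ 2 := by
      rw [← Real.exp_nat_mul]; congr 1; push_cast; ring
    have h9 : a * b * Real.exp (b / 16) ≤ 64 * (Real.exp (a / 4) + Real.exp (b / 4)) := by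
      rw [h7, h8]
      nlinarith [sq_nonneg (Real.exp (a / 8) - Real.exp (b / 8))]
    nlinarith [mul_le_mul_of_nonneg_left h9 hl0.le]
  have hint : Integrable (fun z : E => 1 + 1 / (16 * r) * (64 *
      (Real.exp (inner ℝ z v ^ 2 / 4) + Real.exp (inner ℝ z w ^ 2 / 4)))) (stdGaussian E) :=
    (integrable_const _).add (((iv.add iw).const_mul _).const_mul _)
  have hI : Integrable (fun z : E => Real.exp (1 / (16 * r) *
        (min (inner ℝ z v ^ 2) r * inner ℝ z w ^ 2))) (stdGaussian E) := by
    refine hint.mono' (by fun_prop) (Filter.Eventually.of_forall fun z => ?_)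
    simpa using hle z
  refine ⟨hI, (integral_mono hI hint hle).trans ?_⟩
  have hsum : Integrable (fun z : E =>
      Real.exp (inner ℝ z v ^ 2 / 4) + Real.exp (inner ℝ z w ^ 2 / 4)) (stdGaussian E) := iv.add iw
  rw [integral_add (integrable_const _) ((hsum.const_mul _).const_mul _),
    integral_const_mul, integral_const_mul, integral_add iv iw]
  simp only [integral_const, probReal_univ, one_smul]
  have hl0 : 0 < 1 / (16 * r) := by positivity
  have := Real.add_one_le_exp (256 * (1 / (16 * r)))
  nlinarith

end Gaussian

/-! ### Chernoff and Markov bounds for sums over the sample. -/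

section Tail

variable {Ω E : Type*} [MeasurableSpace Ω] {P : Measure Ω}
  [MeasurableSpace E] {γ : Measure E} {n : ℕ} {Z : Fin n → Ω → E}

/-- Chernoff's bound for a sum of independent identically distributed variables. -/
lemma measureReal_sum_ge_le_exp [IsProbabilityMeasure P] (hlaw : ∀ i, HasLaw (Z i) γ P) (hind : iIndepFun Z P)
    {f : E → ℝ} (hf : Measurable f) {l k t : ℝ} (hl : 0 ≤ l)
    (hint : Integrable (fun z => Real.exp (l * f z)) γ)
    (hk : ∫ z, Real.exp (l * f z) ∂γ ≤ Real.exp k) :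
    P.real {ω | t * n ≤ ∑ i, f (Z i ω)} ≤ Real.exp (n * (k - l * t)) := by
  have hindf : iIndepFun (fun i => f ∘ Z i) P := hind.comp _ fun _ => hf
  have hmeas : ∀ i, AEMeasurable (f ∘ Z i) P := fun i =>
    hf.comp_aemeasurable (hlaw i).aemeasurable
  have hm : ∀ i, mgf (f ∘ Z i) P l = ∫ z, Real.exp (l * f z) ∂γ := fun i => by
    rw [mgf, ← (hlaw i).integral_comp hint.aestronglyMeasurable]
    rfl
  have hi : ∀ i, Integrable (fun ω => Real.exp (l * (f ∘ Z i) ω)) P := fun i => by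
    have := hint
    rw [← (hlaw i).map_eq] at this
    exact (integrable_map_measure this.aestronglyMeasurable (hlaw i).aemeasurable).1 this
  -- If integrability failed, the `mgf` would take its default value `0`; by independence it is a
  -- product of positive factors.
  have hI : Integrable (fun ω => Real.exp (l * (∑ i, f ∘ Z i) ω)) P := by
    by_contra hI
    have h := mgf_undef hI
    rw [hindf.mgf_sum₀ hmeas] at h
    exact (Finset.prod_pos fun i _ => mgf_pos (hi i)).ne' h
  have h := measure_ge_le_exp_mul_mgf (t * n) hl hI
  rw [hindf.mgf_sum₀ hmeas] at h
  simp only [Finset.sum_apply, Function.comp_apply] at h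
  refine h.trans ?_
  have h2 : ∏ i, mgf (f ∘ Z i) P l ≤ Real.exp (n * k) := by
    simp only [hm, Finset.prod_const, Finset.card_univ, Fintype.card_fin]
    rw [Real.exp_nat_mul]
    exact pow_le_pow_left₀ (integral_nonneg fun _ => (Real.exp_pos _).le) hk n
  calc _ ≤ Real.exp (-l * (t * n)) * Real.exp (n * k) :=
        mul_le_mul_of_nonneg_left h2 (Real.exp_pos _).le
    _ = _ := by rw [← Real.exp_add]; congr 1; ring

/-- Markov's bound for a sum of identically distributed nonnegative variables. -/
lemma measureReal_sum_ge_le_div (hlaw : ∀ i, HasLaw (Z i) γ P)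
    {f : E → ℝ} (hf0 : ∀ z, 0 ≤ f z) (hint : Integrable f γ) {k t : ℝ} (ht : 0 < t) (hn : 0 < n)
    (hk : ∫ z, f z ∂γ ≤ k) :
    P.real {ω | t * n ≤ ∑ i, f (Z i ω)} ≤ k / t := by
  have hi : ∀ i, Integrable (fun ω => f (Z i ω)) P := fun i => by
    have := hint
    rw [← (hlaw i).map_eq] at this
    exact (integrable_map_measure this.aestronglyMeasurable (hlaw i).aemeasurable).1 this
  have hn' : (0 : ℝ) < n := by exact_mod_cast hn
  have h := mul_meas_ge_le_integral_of_nonneg (μ := P) (f := fun ω => ∑ i, f (Z i ω))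
    (Filter.Eventually.of_forall fun ω => Finset.sum_nonneg fun i _ => hf0 _)
    (integrable_finsetSum _ fun i _ => hi i) (t * n)
  rw [integral_finsetSum _ fun i _ => hi i] at h
  have h2 : ∑ i, ∫ ω, f (Z i ω) ∂P ≤ n * k := by
    have : ∀ i, ∫ ω, f (Z i ω) ∂P ≤ k := fun i => by
      rw [← (hlaw i).integral_comp hint.aestronglyMeasurable] at hk
      exact hk
    simpa using Finset.sum_le_sum fun (i : Fin n) (_ : i ∈ Finset.univ) => this i
  rw [le_div_iff₀ ht]
  nlinarith

end Tail

/-! ### Grid nets of the Euclidean ball. -/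

section Net

/-- Rounding a real number towards zero moves it by at most one. -/
lemma exists_int_abs_le_abs_sub_le (x : ℝ) : ∃ k : ℤ, |(k : ℝ)| ≤ |x| ∧ |x - k| ≤ 1 := by
  rcases le_total 0 x with h | h
  · refine ⟨⌊x⌋, ?_, ?_⟩
    · rw [abs_of_nonneg h, abs_of_nonneg (by exact_mod_cast Int.floor_nonneg.2 h)]
      exact Int.floor_le x
    · rw [abs_le]; constructor <;> linarith [Int.floor_le x, Int.lt_floor_add_one x]
  · refine ⟨⌈x⌉, ?_, ?_⟩
    · rw [abs_of_nonpos h, abs_of_nonpos (by exact_mod_cast Int.ceil_le.2 (by simpa using h))]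
      linarith [Int.le_ceil x]
    · rw [abs_le]; constructor <;> linarith [Int.le_ceil x, Int.ceil_lt_add_one x]

/-- A grid net of the Euclidean unit ball, consisting of vectors in the unit ball. -/
lemma exists_finset_net (d m : ℕ) (hm : 0 < m) :
    ∃ N : Finset (EuclideanSpace ℝ (Fin d)), N.card ≤ (2 * m + 1) ^ d ∧ (∀ v ∈ N, ‖v‖ ≤ 1) ∧
      ∀ v : EuclideanSpace ℝ (Fin d), ‖v‖ ≤ 1 → ∃ v' ∈ N, ‖v - v'‖ ^ 2 ≤ d / (m : ℝ) ^ 2 := by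
  classical
  have hm' : (0 : ℝ) < m := by exact_mod_cast hm
  let g : (Fin d → ℤ) → EuclideanSpace ℝ (Fin d) := fun k => WithLp.toLp 2 fun j => (k j : ℝ) / m
  refine ⟨((Fintype.piFinset fun _ => Finset.Icc (-(m : ℤ)) m).image g).filter (‖·‖ ≤ 1),
    ?_, fun v hv => (Finset.mem_filter.1 hv).2, fun v hv => ?_⟩
  · refine (Finset.card_filter_le _ _).trans (Finset.card_image_le.trans ?_)
    rw [Fintype.card_piFinset]
    simp only [Int.card_Icc, Finset.prod_const, Finset.card_univ, Fintype.card_fin]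
    refine Nat.pow_le_pow_left ?_ d
    omega
  -- Rounding towards zero shrinks every coordinate, so the grid point stays in the unit ball.
  · choose k hk1 hk2 using fun j => exists_int_abs_le_abs_sub_le (m * v j)
    have hle : ∀ j, |(k j : ℝ) / m| ≤ |v j| := fun j => by
      rw [abs_div, abs_of_pos hm', div_le_iff₀ hm']
      have := hk1 j
      rw [abs_mul, abs_of_pos hm'] at this
      linarith
    have hsub : ∀ j, |v j - (k j : ℝ) / m| ≤ 1 / m := fun j => by
      have : v j - (k j : ℝ) / m = (m * v j - k j) / m := by field_simp
      rw [this, abs_div, abs_of_pos hm']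
      exact div_le_div_of_nonneg_right (hk2 j) hm'.le
    refine ⟨g k, Finset.mem_filter.2 ⟨Finset.mem_image_of_mem g ?_, ?_⟩, ?_⟩
    · rw [Fintype.mem_piFinset]
      intro j
      have h1 : |v j| ≤ 1 := (by simpa using PiLp.norm_apply_le v j : |v j| ≤ ‖v‖).trans hv
      have h2 := (hle j).trans h1
      rw [abs_div, abs_of_pos hm', div_le_one hm'] at h2
      rw [Finset.mem_Icc, ← abs_le]
      exact_mod_cast h2
    · refine le_trans ((sq_le_sq₀ (norm_nonneg _) (norm_nonneg _)).1 ?_) hv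
      rw [EuclideanSpace.real_norm_sq_eq, EuclideanSpace.real_norm_sq_eq]
      exact Finset.sum_le_sum fun j _ => sq_le_sq.2 (hle j)
    · rw [EuclideanSpace.real_norm_sq_eq]
      calc ∑ j, (v - g k) j ^ 2 ≤ ∑ _j : Fin d, (1 / (m : ℝ)) ^ 2 :=
            Finset.sum_le_sum fun j _ => sq_le_sq.2 <| by
              rw [abs_of_nonneg (a := 1 / (m : ℝ)) (by positivity)]
              simpa [g] using hsub j
        _ = d / (m : ℝ) ^ 2 := by simp; field_simp

/-- A net of mesh `1 / d` of the unit ball with at most `exp (4 d log d)` points. -/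
lemma exists_finset_net_inv (d : ℕ) (hd : 2 ≤ d) :
    ∃ N : Finset (EuclideanSpace ℝ (Fin d)), (N.card : ℝ) ≤ Real.exp (4 * (d * Real.log d)) ∧
      (∀ v ∈ N, ‖v‖ ≤ 1) ∧
      ∀ v : EuclideanSpace ℝ (Fin d), ‖v‖ ≤ 1 → ∃ v' ∈ N, ‖v - v'‖ ^ 2 ≤ 1 / (d : ℝ) ^ 2 := by
  -- With `m = d²` the squared mesh is `d / d⁴ ≤ 1 / d²`.
  obtain ⟨N, h1, h2, h3⟩ := exists_finset_net d (d ^ 2) (by positivity)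
  have hd' : (2 : ℝ) ≤ d := by exact_mod_cast hd
  refine ⟨N, ?_, h2, fun v hv => ?_⟩
  · have h4 : 2 * d ^ 2 + 1 ≤ d ^ 4 := by nlinarith [Nat.mul_le_mul hd hd]
    have h5 : N.card ≤ (d ^ 4) ^ d := h1.trans (Nat.pow_le_pow_left h4 d)
    have h6 : Real.exp (4 * (d * Real.log d)) = ((d : ℝ) ^ 4) ^ d := by
      have : 4 * (d * Real.log d) = ((4 * d : ℕ) : ℝ) * Real.log d := by push_cast; ring
      rw [this, Real.exp_nat_mul, Real.exp_log (by positivity), pow_mul]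
    rw [h6]
    exact_mod_cast h5
  · obtain ⟨v', hv', h⟩ := h3 v hv
    refine ⟨v', hv', h.trans ?_⟩
    push_cast
    rw [div_le_div_iff₀ (by positivity) (by positivity)]
    nlinarith [sq_nonneg ((d : ℝ) ^ 2), mul_nonneg (by positivity : (0 : ℝ) ≤ (d : ℝ) ^ 3)
      (by linarith : (0 : ℝ) ≤ d - 1)]

end Net

/-! ### From bounds on a net to bounds in all directions. -/

section Deterministic

variable {E : Type*} [NormedAddCommGroup E] [InnerProductSpace ℝ E]

lemma real_inner_sq_le_of_dist_sq_le (z v v' : E) {e : ℝ} (h : ‖v - v'‖ ^ 2 ≤ e) :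
    inner ℝ z v ^ 2 ≤ 2 * inner ℝ z v' ^ 2 + 2 * (e * ‖z‖ ^ 2) := by
  have h1 : inner ℝ z v = inner ℝ z v' + inner ℝ z (v - v') := by
    rw [← inner_add_right]; congr 1; abel
  have h2 : inner ℝ z (v - v') ^ 2 ≤ ‖z‖ ^ 2 * ‖v - v'‖ ^ 2 := by
    rw [← mul_pow, sq_le_sq, abs_of_nonneg (by positivity : 0 ≤ ‖z‖ * ‖v - v'‖)]
    exact abs_real_inner_le_norm _ _
  have h3 : ‖z‖ ^ 2 * ‖v - v'‖ ^ 2 ≤ ‖z‖ ^ 2 * e := mul_le_mul_of_nonneg_left h (sq_nonneg _)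
  rw [h1]
  nlinarith [sq_nonneg (inner ℝ z v' - inner ℝ z (v - v'))]

lemma real_inner_sq_le_norm_sq (z : E) {v : E} (hv : ‖v‖ ≤ 1) : inner ℝ z v ^ 2 ≤ ‖z‖ ^ 2 := by
  rw [sq_le_sq, abs_norm]
  exact (abs_real_inner_le_norm _ _).trans (mul_le_of_le_one_right (norm_nonneg _) hv)

/-- Truncation at `v` survives the move to `v'`: as `⟨z, v⟩² ≤ r`, the bound `2 ⟨z, v'⟩² + error`
remains valid with `⟨z, v'⟩²` replaced by its minimum with `r`. All cross terms are of order `e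
‖z‖⁴`. -/
lemma inner_sq_mul_inner_sq_le (z : E) {v v' w w' : E} (hv' : ‖v'‖ ≤ 1) (hw : ‖w‖ ≤ 1)
    {e r : ℝ} (hv : ‖v - v'‖ ^ 2 ≤ e) (hww : ‖w - w'‖ ^ 2 ≤ e) (hr : inner ℝ z v ^ 2 ≤ r) :
    inner ℝ z v ^ 2 * inner ℝ z w ^ 2 ≤
      4 * (min (inner ℝ z v' ^ 2) r * inner ℝ z w' ^ 2) + 6 * (e * ‖z‖ ^ 4) := by
  have h1 := real_inner_sq_le_of_dist_sq_le z v v' hv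
  have h2 := real_inner_sq_le_of_dist_sq_le z w w' hww
  have h3 := real_inner_sq_le_norm_sq z hw
  have h4 := real_inner_sq_le_norm_sq z hv'
  have he : 0 ≤ e := (sq_nonneg _).trans hv
  rw [show ‖z‖ ^ 4 = ‖z‖ ^ 2 * ‖z‖ ^ 2 by ring]
  have hp := sq_nonneg (inner ℝ z v)
  have hq := sq_nonneg (inner ℝ z w)
  have hp' := sq_nonneg (inner ℝ z v')
  have hs := sq_nonneg ‖z‖
  generalize inner ℝ z v ^ 2 = p at *
  generalize inner ℝ z w ^ 2 = q at *
  generalize inner ℝ z v' ^ 2 = p' at *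
  generalize inner ℝ z w' ^ 2 = q' at *
  generalize ‖z‖ ^ 2 = s at *
  have hm0 : 0 ≤ min p' r := le_min hp' (hp.trans hr)
  have hms : min p' r ≤ s := (min_le_left _ _).trans h4
  have h5 : p ≤ 2 * min p' r + 2 * (e * s) := by
    rcases min_choice p' r with h | h <;> rw [h] <;> nlinarith [mul_nonneg he hs]
  have hes := mul_nonneg he hs
  calc p * q ≤ (2 * min p' r + 2 * (e * s)) * q := mul_le_mul_of_nonneg_right h5 hq
    _ = 2 * (min p' r * q) + 2 * (e * s) * q := by ring
    _ ≤ 2 * (min p' r * (2 * q' + 2 * (e * s))) + 2 * (e * s) * s := by gcongr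
    _ = 4 * (min p' r * q') + 4 * (min p' r * (e * s)) + 2 * (e * s) * s := by ring
    _ ≤ 4 * (min p' r * q') + 4 * (s * (e * s)) + 2 * (e * s) * s := by gcongr
    _ = _ := by ring

/-- Moment bounds on a net of the unit ball imply bounds, on large subfamilies, of the weighted
second moments in all directions. -/
lemma exists_finset_sum_inner_sq_mul_le {n : ℕ} {z : Fin n → E} {N : Finset E} {δ ε : ℝ}
    (hε : 0 < ε) (hδ : δ ≤ 1) (hN : ∀ v ∈ N, ‖v‖ ≤ 1)
    (hnet : ∀ v : E, ‖v‖ ≤ 1 → ∃ v' ∈ N, ‖v - v'‖ ^ 2 ≤ δ)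
    (h4 : δ * ∑ i, ‖z i‖ ^ 4 ≤ 2560 * n)
    (h2 : ∀ v ∈ N, ∑ i, inner ℝ (z i) v ^ 2 ≤ 8 * n)
    (ht : ∀ v ∈ N, ∀ w ∈ N,
      ∑ i, min (inner ℝ (z i) v ^ 2) (3000 / ε ^ 2) * inner ℝ (z i) w ^ 2 ≤ 512 * n)
    (v : E) :
    ∃ T : Finset (Fin n), (1 - ε ^ 2) * n ≤ T.card ∧
      ∀ w : E, ∑ i ∈ T, inner ℝ (z i) v ^ 2 * inner ℝ (z i) w ^ 2 ≤
        17408 * n * (‖v‖ ^ 2 * ‖w‖ ^ 2) := by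
  classical
  by_cases hv0 : v = 0
  · refine ⟨Finset.univ, ?_, fun w => by simp [hv0]⟩
    simp only [Finset.card_univ, Fintype.card_fin]
    nlinarith [mul_nonneg (sq_nonneg ε) (Nat.cast_nonneg n : (0 : ℝ) ≤ n)]
  have key : ∀ v : E, ‖v‖ = 1 → ∃ T : Finset (Fin n), (1 - ε ^ 2) * n ≤ T.card ∧
      ∀ w : E, ‖w‖ = 1 → ∑ i ∈ T, inner ℝ (z i) v ^ 2 * inner ℝ (z i) w ^ 2 ≤ 17408 * n := by
    intro v hv
    obtain ⟨v', hv', hvv⟩ := hnet v hv.le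
    have hδ0 : 0 ≤ δ := (sq_nonneg _).trans hvv
    have hsum : ∑ i, inner ℝ (z i) v ^ 2 ≤ 3000 * n := by
      -- The net error `2 δ ‖z‖²` is at most `δ ‖z‖⁴ + δ`, so the fourth-moment bound controls it;
      -- the sum is at most `(16 + 2560 + 1) n`.
      have h : ∀ i, inner ℝ (z i) v ^ 2 ≤ 2 * inner ℝ (z i) v' ^ 2 + (δ * ‖z i‖ ^ 4 + 1) := by
        intro i
        have := real_inner_sq_le_of_dist_sq_le (z i) v v' hvv
        nlinarith [mul_nonneg hδ0 (sq_nonneg (‖z i‖ ^ 2 - 1))]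
      have := Finset.sum_le_sum fun i (_ : i ∈ Finset.univ) => h i
      rw [Finset.sum_add_distrib, Finset.sum_add_distrib, ← Finset.mul_sum, ← Finset.mul_sum] at this
      simp only [Finset.sum_const, Finset.card_univ, Fintype.card_fin, nsmul_eq_mul,
        mul_one] at this
      have hn : (0 : ℝ) ≤ n := Nat.cast_nonneg n
      linarith [h2 v' hv']
    -- This set depends on `v` only, hence serves all `w` at once.
    set T := Finset.univ.filter fun i => inner ℝ (z i) v ^ 2 ≤ 3000 / ε ^ 2 with hT
    refine ⟨T, ?_, fun w hw => ?_⟩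
    · have hc : (Tᶜ.card : ℝ) * (3000 / ε ^ 2) ≤ 3000 * n := by
        rw [← nsmul_eq_mul]
        refine (Finset.card_nsmul_le_sum _ (fun i => inner ℝ (z i) v ^ 2) _ fun i hi => ?_).trans
          ((Finset.sum_le_univ_sum_of_nonneg fun i => sq_nonneg _).trans hsum)
        simp only [hT, Finset.mem_compl, Finset.mem_filter, Finset.mem_univ, true_and,
          not_le] at hi
        exact hi.le
      rw [mul_div_assoc', div_le_iff₀ (by positivity)] at hc
      have hcard : (T.card : ℝ) + Tᶜ.card = n := by
        exact_mod_cast (Finset.card_add_card_compl T).trans (Fintype.card_fin n)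
      nlinarith
    · obtain ⟨w', hw', hww⟩ := hnet w hw.le
      have hr : (0 : ℝ) ≤ 3000 / ε ^ 2 := by positivity
      calc ∑ i ∈ T, inner ℝ (z i) v ^ 2 * inner ℝ (z i) w ^ 2
          ≤ ∑ i ∈ T, (4 * (min (inner ℝ (z i) v' ^ 2) (3000 / ε ^ 2) * inner ℝ (z i) w' ^ 2) +
              6 * (δ * ‖z i‖ ^ 4)) := Finset.sum_le_sum fun i hi =>
            inner_sq_mul_inner_sq_le (z i) (hN v' hv') hw.le hvv hww (Finset.mem_filter.1 hi).2
        _ ≤ ∑ i, (4 * (min (inner ℝ (z i) v' ^ 2) (3000 / ε ^ 2) * inner ℝ (z i) w' ^ 2) +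
              6 * (δ * ‖z i‖ ^ 4)) := Finset.sum_le_univ_sum_of_nonneg fun i => by positivity
        _ = 4 * ∑ i, min (inner ℝ (z i) v' ^ 2) (3000 / ε ^ 2) * inner ℝ (z i) w' ^ 2 +
              6 * (δ * ∑ i, ‖z i‖ ^ 4) := by
            rw [Finset.sum_add_distrib, ← Finset.mul_sum, ← Finset.mul_sum, ← Finset.mul_sum]
        -- `17408 = 4 * 512 + 6 * 2560`.
        _ ≤ 17408 * n := by linarith [ht v' hv' w' hw']
  obtain ⟨T, hT, h⟩ := key (‖v‖⁻¹ • v) (norm_smul_inv_norm hv0)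
  refine ⟨T, hT, fun w => ?_⟩
  by_cases hw0 : w = 0
  · simp [hw0]
  have h := h (‖w‖⁻¹ • w) (norm_smul_inv_norm hw0)
  have hpos : 0 < ‖v‖ ^ 2 * ‖w‖ ^ 2 := by
    have := norm_pos_iff.2 hv0
    have := norm_pos_iff.2 hw0
    positivity
  rw [← div_le_iff₀ hpos, Finset.sum_div]
  refine le_trans (le_of_eq (Finset.sum_congr rfl fun i _ => ?_)) h
  rw [inner_smul_right, inner_smul_right]
  field_simp

end Deterministic

/-! ### The good event for standard Gaussian samples. -/

section StdGaussian

variable {Ω : Type*} [MeasurableSpace Ω] {P : Measure Ω} {d n : ℕ}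
  {Z : Fin n → Ω → EuclideanSpace ℝ (Fin d)}

lemma exp_neg_four_le : Real.exp (-4) ≤ 1 / 40 := by
  have h1 := Real.exp_one_gt_d9
  have h2 : Real.exp 4 = Real.exp 1 ^ 4 := by rw [← Real.exp_nat_mul]; norm_num
  have h3 : (40 : ℝ) ≤ Real.exp 4 := by
    rw [h2]
    calc (40 : ℝ) ≤ 2.7 ^ 4 := by norm_num
      _ ≤ _ := pow_le_pow_left₀ (by norm_num) (by linarith) 4
  rw [Real.exp_neg, ← one_div]
  exact one_div_le_one_div_of_le (by norm_num) h3

lemma measureReal_sum_norm_pow_four_ge_le (hlaw : ∀ i, HasLaw (Z i) (stdGaussian _) P)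
    (hd : 0 < d) (hn : 0 < n) :
    P.real {ω | 2560 * (d : ℝ) ^ 2 * n ≤ ∑ i, ‖Z i ω‖ ^ 4} ≤ 1 / 20 := by
  have hd' : (0 : ℝ) < d := by exact_mod_cast hd
  obtain ⟨h1, h2⟩ := integral_norm_pow_four_stdGaussian_le d
  refine (measureReal_sum_ge_le_div hlaw (fun _ => by positivity) h1 (by positivity) hn h2).trans
    (le_of_eq ?_)
  field_simp
  norm_num

lemma measureReal_sum_inner_sq_ge_le [IsProbabilityMeasure P]
    (hlaw : ∀ i, HasLaw (Z i) (stdGaussian _) P)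
    (hind : iIndepFun Z P) {v : EuclideanSpace ℝ (Fin d)} (hv : ‖v‖ ≤ 1) :
    P.real {ω | 8 * (n : ℝ) ≤ ∑ i, inner ℝ (Z i ω) v ^ 2} ≤ Real.exp (-n) := by
  obtain ⟨h1, h2⟩ := integral_exp_sq_inner_stdGaussian_le hv
  have he : ∀ z : EuclideanSpace ℝ (Fin d),
      Real.exp (inner ℝ z v ^ 2 / 4) = Real.exp (1 / 4 * inner ℝ z v ^ 2) := fun z => by
    congr 1; ring
  simp only [he] at h1 h2
  refine (measureReal_sum_ge_le_exp hlaw hind (f := fun z => inner ℝ z v ^ 2) (by fun_prop)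
    (by norm_num) h1 (h2.trans (?_ : _ ≤ Real.exp 1))).trans (le_of_eq ?_)
  · linarith [Real.exp_one_gt_d9]
  · congr 1; ring

/-- The threshold `512` is twice the `256` of the log-moment, so the Chernoff exponent is `-256 n /
(16 r)`. -/
lemma measureReal_sum_truncated_ge_le [IsProbabilityMeasure P]
    (hlaw : ∀ i, HasLaw (Z i) (stdGaussian _) P)
    (hind : iIndepFun Z P) {v w : EuclideanSpace ℝ (Fin d)} (hv : ‖v‖ ≤ 1) (hw : ‖w‖ ≤ 1)
    {r : ℝ} (hr : 0 < r) :
    P.real {ω | 512 * (n : ℝ) ≤ ∑ i, min (inner ℝ (Z i ω) v ^ 2) r * inner ℝ (Z i ω) w ^ 2} ≤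
      Real.exp (-(16 * n / r)) := by
  obtain ⟨h1, h2⟩ := integral_exp_truncated_stdGaussian_le hv hw hr
  refine (measureReal_sum_ge_le_exp hlaw hind
    (f := fun z => min (inner ℝ z v ^ 2) r * inner ℝ z w ^ 2) (by fun_prop)
    (by positivity) h1 h2).trans (le_of_eq ?_)
  congr 1
  field_simp
  ring

/-- Standard Gaussian samples have, outside an event of small probability, bounded weighted second
moments on large subfamilies. -/
lemma exists_measureReal_le_forall_notMem [IsProbabilityMeasure P]
    (hlaw : ∀ i, HasLaw (Z i) (stdGaussian _) P)
    (hind : iIndepFun Z P) {ε : ℝ} (hε : 0 < ε) (hε1 : ε ≤ 1)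
    (hn : 3000 * (d * Real.log d / ε ^ 2) ≤ n) :
    ∃ B : Set Ω, P.real B ≤ 1 / 10 ∧ ∀ ω ∉ B, ∀ v : EuclideanSpace ℝ (Fin d),
      ∃ T : Finset (Fin n), (1 - ε ^ 2) * n ≤ T.card ∧
      ∀ w, ∑ i ∈ T, inner ℝ (Z i ω) v ^ 2 * inner ℝ (Z i ω) w ^ 2 ≤
        17408 * n * (‖v‖ ^ 2 * ‖w‖ ^ 2) := by
  rcases Nat.eq_zero_or_pos n with rfl | hn0
  · exact ⟨∅, by simp, fun ω _ v => ⟨∅, by simp, fun w => by simp⟩⟩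
  rcases Nat.eq_zero_or_pos d with rfl | hd0
  · refine ⟨∅, by simp, fun ω _ v => ⟨Finset.univ, ?_, fun w => by simp [Subsingleton.elim v 0]⟩⟩
    simp only [Finset.card_univ, Fintype.card_fin]
    nlinarith [mul_nonneg (sq_nonneg ε) (Nat.cast_nonneg n : (0 : ℝ) ≤ n)]
  have hM := measureReal_sum_norm_pow_four_ge_le hlaw hd0 hn0
  set M := {ω | 2560 * (d : ℝ) ^ 2 * n ≤ ∑ i, ‖Z i ω‖ ^ 4} with hMdef
  -- For `d = 1`, `log d = 0` gives no lower bound on `n` to pay for a union bound; there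
  -- Cauchy–Schwarz and the fourth-moment event suffice, with no index removed.
  rcases Nat.lt_or_ge d 2 with hd | hd
  · obtain rfl : d = 1 := by omega
    refine ⟨M, by linarith, fun ω hω v => ⟨Finset.univ, ?_, fun w => ?_⟩⟩
    · simp only [Finset.card_univ, Fintype.card_fin]
      nlinarith [mul_nonneg (sq_nonneg ε) (Nat.cast_nonneg n : (0 : ℝ) ≤ n)]
    · simp only [hMdef, Set.mem_ofPred_eq, not_le, Nat.cast_one, one_pow, mul_one] at hω
      have hle : ∀ i, inner ℝ (Z i ω) v ^ 2 * inner ℝ (Z i ω) w ^ 2 ≤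
          ‖Z i ω‖ ^ 4 * (‖v‖ ^ 2 * ‖w‖ ^ 2) := fun i => by
        have h1 : ∀ u, inner ℝ (Z i ω) u ^ 2 ≤ (‖Z i ω‖ * ‖u‖) ^ 2 := fun u => by
          rw [sq_le_sq, abs_of_nonneg (by positivity : 0 ≤ ‖Z i ω‖ * ‖u‖)]
          exact abs_real_inner_le_norm _ _
        calc _ ≤ (‖Z i ω‖ * ‖v‖) ^ 2 * (‖Z i ω‖ * ‖w‖) ^ 2 :=
              mul_le_mul (h1 v) (h1 w) (by positivity) (by positivity)
          _ = _ := by ring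
      refine (Finset.sum_le_sum fun i _ => hle i).trans ?_
      rw [← Finset.sum_mul]
      refine mul_le_mul_of_nonneg_right ?_ (by positivity)
      linarith [(Nat.cast_nonneg n : (0 : ℝ) ≤ n)]
  have hd' : (2 : ℝ) ≤ d := by exact_mod_cast hd
  obtain ⟨N, hcard, hN, hnet⟩ := exists_finset_net_inv d hd
  have hD : 1.38 ≤ d * Real.log d := by
    have h1 : Real.log 2 ≤ Real.log d := Real.log_le_log (by norm_num) hd'
    nlinarith [Real.log_two_gt_d9]
  set D := d * Real.log d with hDdef
  have hεn : 3000 * D ≤ ε ^ 2 * n := by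
    rw [mul_div_assoc', div_le_iff₀ (by positivity)] at hn
    linarith
  have hDn : 3000 * D ≤ n := by
    have : ε ^ 2 ≤ 1 := pow_le_one₀ hε.le hε1
    nlinarith [(Nat.cast_nonneg n : (0 : ℝ) ≤ n)]
  set r := 3000 / ε ^ 2 with hr
  have hr0 : 0 < r := by positivity
  let B2 : EuclideanSpace ℝ (Fin d) → Set Ω := fun v =>
    {ω | 8 * (n : ℝ) ≤ ∑ i, inner ℝ (Z i ω) v ^ 2}
  let B3 : EuclideanSpace ℝ (Fin d) → EuclideanSpace ℝ (Fin d) → Set Ω := fun v w =>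
    {ω | 512 * (n : ℝ) ≤ ∑ i, min (inner ℝ (Z i ω) v ^ 2) r * inner ℝ (Z i ω) w ^ 2}
  have hB2 : P.real (⋃ v ∈ N, B2 v) ≤ 1 / 40 := by
    calc P.real (⋃ v ∈ N, B2 v) ≤ ∑ v ∈ N, P.real (B2 v) := measureReal_biUnion_finset_le _ _
      _ ≤ ∑ _v ∈ N, Real.exp (-n) := Finset.sum_le_sum fun v hv =>
          measureReal_sum_inner_sq_ge_le hlaw hind (hN v hv)
      _ = N.card * Real.exp (-n) := by simp
      _ ≤ Real.exp (4 * D) * Real.exp (-n) :=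
          mul_le_mul_of_nonneg_right hcard (Real.exp_pos _).le
      _ = Real.exp (4 * D - n) := by rw [← Real.exp_add]; rfl
      _ ≤ Real.exp (-4) := Real.exp_le_exp.2 (by linarith)
      _ ≤ 1 / 40 := exp_neg_four_le
  have hB3 : P.real (⋃ v ∈ N, ⋃ w ∈ N, B3 v w) ≤ 1 / 40 := by
    have h16 : 16 * D ≤ 16 * n / r := by
      rw [hr, div_div_eq_mul_div, le_div_iff₀ (by norm_num)]
      linarith
    calc P.real (⋃ v ∈ N, ⋃ w ∈ N, B3 v w) ≤ ∑ v ∈ N, ∑ w ∈ N, P.real (B3 v w) :=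
          (measureReal_biUnion_finset_le _ _).trans
            (Finset.sum_le_sum fun v _ => measureReal_biUnion_finset_le _ _)
      _ ≤ ∑ _v ∈ N, ∑ _w ∈ N, Real.exp (-(16 * n / r)) := Finset.sum_le_sum fun v hv =>
          Finset.sum_le_sum fun w hw =>
            measureReal_sum_truncated_ge_le hlaw hind (hN v hv) (hN w hw) hr0
      _ = N.card * (N.card * Real.exp (-(16 * n / r))) := by simp
      _ ≤ Real.exp (4 * D) * (Real.exp (4 * D) * Real.exp (-(16 * n / r))) := by gcongr
      _ = Real.exp (4 * D + (4 * D + -(16 * n / r))) := by rw [← Real.exp_add, ← Real.exp_add]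
      _ ≤ Real.exp (-4) := Real.exp_le_exp.2 (by linarith)
      _ ≤ 1 / 40 := exp_neg_four_le
  -- The budget is `1 / 20 + 1 / 40 + 1 / 40 = 1 / 10`.
  refine ⟨M ∪ ((⋃ v ∈ N, B2 v) ∪ ⋃ v ∈ N, ⋃ w ∈ N, B3 v w), ?_, fun ω hω v => ?_⟩
  · have h1 := measureReal_union_le (μ := P) M ((⋃ v ∈ N, B2 v) ∪ ⋃ v ∈ N, ⋃ w ∈ N, B3 v w)
    have h2 := measureReal_union_le (μ := P) (⋃ v ∈ N, B2 v) (⋃ v ∈ N, ⋃ w ∈ N, B3 v w)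
    linarith
  · simp only [Set.mem_union, Set.mem_iUnion, not_or, not_exists, hMdef, B2, B3,
      Set.mem_ofPred_eq, not_le] at hω
    obtain ⟨h4, h2, h3⟩ := hω
    refine exists_finset_sum_inner_sq_mul_le hε ?_ hN hnet ?_ (fun v hv => (h2 v hv).le)
      (fun v hv w hw => (h3 v hv w hw).le) v
    · rw [div_le_one (by positivity)]
      nlinarith
    · rw [one_div_mul_eq_div, div_le_iff₀ (by positivity)]
      linarith

end StdGaussian

/-! ### Reduction to the standard Gaussian. -/

section Whitening

variable {d : ℕ} {S : Matrix (Fin d) (Fin d) ℝ}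

lemma inner_toEuclideanCLM_sqrt (x y : EuclideanSpace ℝ (Fin d)) :
    inner ℝ (Matrix.toEuclideanCLM (𝕜 := ℝ) (CFC.sqrt S) x) y =
      inner ℝ x (Matrix.toEuclideanCLM (𝕜 := ℝ) (CFC.sqrt S) y) := by
  have h : IsSelfAdjoint (Matrix.toEuclideanCLM (n := Fin d) (𝕜 := ℝ) (CFC.sqrt S)) :=
    (CFC.sqrt_nonneg S).isSelfAdjoint.map _
  rw [← ContinuousLinearMap.adjoint_inner_right, h.adjoint_eq]

lemma norm_sq_toEuclideanCLM_sqrt (hS : S.PosSemidef) (x : EuclideanSpace ℝ (Fin d)) :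
    ‖Matrix.toEuclideanCLM (𝕜 := ℝ) (CFC.sqrt S) x‖ ^ 2 = mahalanobisSq S x := by
  rw [← real_inner_self_eq_norm_sq, inner_toEuclideanCLM_sqrt, ← mul_apply_eq_comp,
    ← map_mul, CFC.sqrt_mul_sqrt_self _ hS.nonneg, Matrix.inner_toEuclideanCLM]
  rfl

lemma mahalanobisSq_le {L : ℝ} (h : S ≤ L • (1 : Matrix (Fin d) (Fin d) ℝ))
    (x : EuclideanSpace ℝ (Fin d)) : mahalanobisSq S x ≤ L * ‖x‖ ^ 2 := by
  have h1 := (Matrix.le_iff.1 h).dotProduct_mulVec_nonneg x.ofLp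
  simp only [Matrix.sub_mulVec, dotProduct_sub, Matrix.smul_mulVec, Matrix.one_mulVec,
    dotProduct_smul, star_trivial, smul_eq_mul, sub_nonneg] at h1
  rw [EuclideanSpace.real_norm_sq_eq, mahalanobisSq]
  simpa [dotProduct, sq] using h1

lemma posDef_of_smul_one_le {μ : ℝ} (hμ : 0 < μ)
    (h : μ • (1 : Matrix (Fin d) (Fin d) ℝ) ≤ S) : S.PosDef := by
  have h1 := (Matrix.PosDef.one (n := Fin d) (R := ℝ)).smul hμ
  simpa using h1.add_posSemidef (Matrix.le_iff.1 h)

/-- The samples of a nondegenerate centred Gaussian are linear images of standard ones. -/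
lemma multivariateGaussian_map_inv_sqrt (hS : S.PosDef) :
    (multivariateGaussian 0 S).map (Matrix.toEuclideanCLM (𝕜 := ℝ) (CFC.sqrt S)⁻¹) =
        stdGaussian _ ∧
      ∀ x, Matrix.toEuclideanCLM (𝕜 := ℝ) (CFC.sqrt S)
        (Matrix.toEuclideanCLM (𝕜 := ℝ) (CFC.sqrt S)⁻¹ x) = x := by
  have hmul : CFC.sqrt S * CFC.sqrt S = S := CFC.sqrt_mul_sqrt_self _ hS.posSemidef.nonneg
  have hdet : IsUnit (CFC.sqrt S).det := by
    have h := hS.det_pos.ne'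
    rw [← hmul, Matrix.det_mul] at h
    exact (left_ne_zero_of_mul h).isUnit
  constructor
  · rw [multivariateGaussian, Measure.map_map (by fun_prop) (by fun_prop)]
    convert Measure.map_id
    ext1 x
    rw [Function.comp_apply, zero_add, ← mul_apply_eq_comp, ← map_mul,
      Matrix.nonsing_inv_mul _ hdet, map_one]
    rfl
  · intro x
    rw [← mul_apply_eq_comp, ← map_mul, Matrix.mul_nonsing_inv _ hdet, map_one]
    rfl

end Whitening

/-! ### The spectral norm as a quadratic form, and the theorem. -/

lemma inner_toEuclideanCLM_weightedCov {d n : ℕ} (x : Fin n → EuclideanSpace ℝ (Fin d))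
    (u : EuclideanSpace ℝ (Fin d)) (T : Finset (Fin n)) (y w : EuclideanSpace ℝ (Fin d)) :
    inner ℝ y (Matrix.toEuclideanCLM (𝕜 := ℝ) (weightedCov x u T) w) =
      1 / (T.card : ℝ) * ∑ i ∈ T, inner ℝ (x i) u ^ 2 * (inner ℝ (x i) y * inner ℝ (x i) w) := by
  rw [Matrix.inner_toEuclideanCLM, weightedCov, Matrix.smul_mulVec, Matrix.sum_mulVec,
    dotProduct_smul, dotProduct_sum, smul_eq_mul]
  congr 1
  refine Finset.sum_congr rfl fun i _ => ?_
  rw [Matrix.smul_mulVec, dotProduct_smul, smul_eq_mul, Matrix.vecMulVec_mulVec]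
  simp only [EuclideanSpace.inner_eq_star_dotProduct, star_trivial, dotProduct_smul,
    op_smul_eq_smul, smul_eq_mul, dotProduct_comm w.ofLp]
  ring

/-- The spectral norm of `weightedCov` is controlled by its quadratic form. -/
lemma norm_weightedCov_le {d n : ℕ} (x : Fin n → EuclideanSpace ℝ (Fin d))
    (u : EuclideanSpace ℝ (Fin d)) (T : Finset (Fin n)) {C : ℝ} (hC : 0 ≤ C)
    (h : ∀ w, ‖w‖ = 1 →
      1 / (T.card : ℝ) * ∑ i ∈ T, inner ℝ (x i) u ^ 2 * inner ℝ (x i) w ^ 2 ≤ C) :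
    ‖weightedCov x u T‖ ≤ C := by
  rw [Matrix.cstar_norm_def]
  refine ContinuousLinearMap.opNorm_le_of_unit_norm hC fun w hw => ?_
  set M := Matrix.toEuclideanCLM (𝕜 := ℝ) (weightedCov x u T) with hM
  by_cases h0 : M w = 0
  · rw [h0, norm_zero]; exact hC
  set y := ‖M w‖⁻¹ • M w with hy
  have hy1 : ‖y‖ = 1 := norm_smul_inv_norm h0
  have h1 : ‖M w‖ = inner ℝ y (M w) := by
    rw [hy, real_inner_smul_left, real_inner_self_eq_norm_sq, sq,
      inv_mul_cancel_left₀ (norm_ne_zero_iff.2 h0)]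
  rw [h1, hM, inner_toEuclideanCLM_weightedCov]
  -- The bilinear form at unit `y`, `w` is at most the mean of its two diagonal values.
  have h2 : ∑ i ∈ T, inner ℝ (x i) u ^ 2 * (inner ℝ (x i) y * inner ℝ (x i) w) ≤
      ∑ i ∈ T, (inner ℝ (x i) u ^ 2 * inner ℝ (x i) y ^ 2 +
        inner ℝ (x i) u ^ 2 * inner ℝ (x i) w ^ 2) / 2 := Finset.sum_le_sum fun i _ => by
    nlinarith [mul_nonneg (sq_nonneg (inner ℝ (x i) u))
      (sq_nonneg (inner ℝ (x i) y - inner ℝ (x i) w))]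
  rw [← Finset.sum_div, Finset.sum_add_distrib] at h2
  have h3 := mul_le_mul_of_nonneg_left h2 (one_div_nonneg.2 (Nat.cast_nonneg T.card : (0 : ℝ) ≤ T.card))
  linarith [h y hy1, h w hw]

/-- On `Matrix (Fin d) (Fin d) ℝ`, `≤` is the Löwner order and `‖·‖` is the spectral
(operator) norm. The set whose probability is bounded below is the preimage under the sample
of a closed set, hence (null-)measurable. -/
theorem mainTheorem4 :
    ∃ ε₀ c Cest : ℝ, 0 < ε₀ ∧ 0 < c ∧ 0 < Cest ∧
      ∀ (ε : ℝ), 0 < ε → ε ≤ ε₀ →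
      ∀ (d n : ℕ) (μ L : ℝ), 0 < μ →
      ∀ (S : Matrix (Fin d) (Fin d) ℝ),
        μ • (1 : Matrix (Fin d) (Fin d) ℝ) ≤ S → S ≤ L • (1 : Matrix (Fin d) (Fin d) ℝ) →
      ∀ (Ω : Type*) [MeasurableSpace Ω] (P : Measure Ω) [IsProbabilityMeasure P]
        (X : Fin n → Ω → EuclideanSpace ℝ (Fin d)),
        (∀ i, HasLaw (X i) (multivariateGaussian 0 S) P) → iIndepFun X P →
        c * (d * Real.log d / ε ^ 4 + d * max (Real.log (L * d / ε ^ 7)) 0 / ε ^ 2) ≤ (n : ℝ) →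
        (9 / 10 : ℝ) ≤ P.real {ω | ∀ u : EuclideanSpace ℝ (Fin d), ∃ T : Finset (Fin n),
          (1 - ε ^ 2) * (n : ℝ) ≤ (T.card : ℝ) ∧
          ‖weightedCov (fun i => X i ω) u T‖ ≤ Cest * L * mahalanobisSq S u} := by
  refine ⟨1 / 2, 3000, 40000, by norm_num, by norm_num, by norm_num, ?_⟩
  intro ε hε hε0 d n μ L hμ S hμS hSL Ω _ P _ X hlaw hind hn
  have hS := posDef_of_smul_one_le hμ hμS
  obtain ⟨hmap, hinv⟩ := multivariateGaussian_map_inv_sqrt hS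
  set A := Matrix.toEuclideanCLM (𝕜 := ℝ) (CFC.sqrt S) with hA
  set A' := Matrix.toEuclideanCLM (𝕜 := ℝ) (CFC.sqrt S)⁻¹ with hA'
  have hZlaw : ∀ i, HasLaw (fun ω => A' (X i ω)) (stdGaussian _) P := fun i =>
    (MeasurePreserving.mk (by fun_prop) hmap).hasLaw.comp (hlaw i)
  have hZind : iIndepFun (fun i ω => A' (X i ω)) P := hind.comp (fun _ => A') fun _ => by fun_prop
  have hε2 : ε ^ 2 ≤ 1 / 4 := by nlinarith
  have hn' : 3000 * (d * Real.log d / ε ^ 2) ≤ n := by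
    refine le_trans (mul_le_mul_of_nonneg_left ?_ (by norm_num)) hn
    have h1 : d * Real.log d / ε ^ 2 ≤ d * Real.log d / ε ^ 4 := by
      refine div_le_div_of_nonneg_left
        (mul_nonneg (Nat.cast_nonneg d) (Real.log_natCast_nonneg d)) (by positivity) ?_
      nlinarith [sq_nonneg ε]
    have h2 : 0 ≤ d * max (Real.log (L * d / ε ^ 7)) 0 / ε ^ 2 :=
      div_nonneg (mul_nonneg (Nat.cast_nonneg d) (le_max_right _ _)) (sq_nonneg _)
    linarith
  obtain ⟨B, hB, hgood⟩ :=
    exists_measureReal_le_forall_notMem hZlaw hZind hε (by linarith) hn'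
  have hsub : Bᶜ ⊆ {ω | ∀ u : EuclideanSpace ℝ (Fin d), ∃ T : Finset (Fin n),
      (1 - ε ^ 2) * (n : ℝ) ≤ (T.card : ℝ) ∧
      ‖weightedCov (fun i => X i ω) u T‖ ≤ 40000 * L * mahalanobisSq S u} := by
    intro ω hω u
    obtain ⟨T, hT, h⟩ := hgood ω hω (A u)
    refine ⟨T, hT, ?_⟩
    have hinner : ∀ i y, inner ℝ (X i ω) y = inner ℝ (A' (X i ω)) (A y) := fun i y => by
      conv_lhs => rw [← hinv (X i ω)]
      exact inner_toEuclideanCLM_sqrt _ _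
    have hu : ‖A u‖ ^ 2 = mahalanobisSq S u := norm_sq_toEuclideanCLM_sqrt hS.posSemidef u
    have hmu : 0 ≤ mahalanobisSq S u := hu ▸ sq_nonneg _
    -- For `d = 0` the number `L` may be negative, but then the quadratic form vanishes.
    have hLu : 0 ≤ L * mahalanobisSq S u := by
      rcases hmu.eq_or_lt with h0 | h0
      · rw [← h0, mul_zero]
      · refine mul_nonneg ?_ hmu
        by_contra! hL
        nlinarith [mahalanobisSq_le hSL u, sq_nonneg ‖u‖]
    refine norm_weightedCov_le _ u T (by linarith) fun w hw => ?_
    simp only [hinner]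
    have hw' : ‖A w‖ ^ 2 ≤ L := by
      have := mahalanobisSq_le hSL w
      rw [hw, one_pow, mul_one] at this
      exact (norm_sq_toEuclideanCLM_sqrt hS.posSemidef w).trans_le this
    have hT' : 3 / 4 * (n : ℝ) ≤ T.card := by
      nlinarith [(Nat.cast_nonneg n : (0 : ℝ) ≤ n)]
    have hsum : ∑ i ∈ T, inner ℝ (A' (X i ω)) (A u) ^ 2 * inner ℝ (A' (X i ω)) (A w) ^ 2 ≤
        40000 * L * mahalanobisSq S u * T.card := by
      calc _ ≤ 17408 * n * (‖A u‖ ^ 2 * ‖A w‖ ^ 2) := h (A w)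
        _ ≤ 17408 * n * (mahalanobisSq S u * L) := by rw [hu]; gcongr
        _ = 17408 * (L * mahalanobisSq S u) * n := by ring
        -- Since `ε ≤ 1 / 2`, `T` contains at least `3 / 4` of the indices, and `17408 * 4 / 3 <
        -- 40000`.
        _ ≤ 17408 * (L * mahalanobisSq S u) * (4 / 3 * T.card) := by gcongr; linarith
        _ ≤ 40000 * L * mahalanobisSq S u * T.card := by
          nlinarith [mul_nonneg hLu (Nat.cast_nonneg T.card : (0 : ℝ) ≤ T.card)]
    rw [one_div_mul_eq_div]
    exact div_le_of_le_mul₀ (Nat.cast_nonneg _) (by linarith) hsum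
  -- Subadditivity is enough here and does not require `B` to be measurable.
  have h1 : 1 ≤ P.real B + P.real Bᶜ := by
    have := measureReal_union_le (μ := P) B Bᶜ
    rwa [Set.union_compl_self, probReal_univ] at this
  linarith [measureReal_mono (μ := P) hsub]
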